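/- Let $G$ be a finite group. For $a,b\in G$ write ${}^{a}b=aba^{-1}$ and $[a,b]=aba^{-1}b^{-1}$. The nonabelian tensor square $G\otimes G$ is the group generated by the symbols $x\otimes y$ ($x,y\in G$) subject to the relations $$xy\otimes h=({}^{x}y\otimes {}^{x}h)(x\otimes h),\qquad x\otimes hk=(x\otimes h)({}^{h}x\otimes {}^{h}k)\qquad (x,y,h,k\in G).$$ Let $\kappa\colon G\otimes G\to G'$ be the homomorphism with $\kappa(x\otimes y)=[x,y]$, and put $$J_2(G)=\ker\kappa,\qquad Z^{\otimes}(G)=\{g\in G : g\otimes y=1 \text{ for all } y\in G\},$$ $$d^{\otimes}(G)=\frac{|\{(x,y)\in G\times G : x\otimes y=1\}|}{|G|^2},\qquad d(G)=\frac{|\{(x,y)\in G\times G : [x,y]=1\}|}{|G|^2}.$$ Suppose that $G$ is nontrivial and let $p$ be the smallest prime divisor of $|G|$. Then $J_2(G)$ is finite and $$\frac{d(G)}{|J_2(G)|}+\frac{|Z^{\otimes}(G)|}{|G|}\left(1-\frac{1}{|J_2(G)|}\right)\ \le\ d^{\otimes}(G)\ \le\ d(G)-\left(1-\frac1p\right)\frac{|Z(G)|-|Z^{\otimes}(G)|}{|G|},$$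 where $Z(G)$ is the center of $G$. -/

import Mathlib

namespace TensorDegree

open scoped commutatorElement

/-- The defining relations of the nonabelian tensor square, as words in the free group on the
symbols `(x, y)` (standing for `x ⊗ y`), where `ᵃb = a * b * a⁻¹`:
`xy ⊗ h = (ˣy ⊗ ˣh) (x ⊗ h)` and `x ⊗ hk = (x ⊗ h) (ʰx ⊗ ʰk)`. -/
def tensorRels (G : Type*) [Group G] : Set (FreeGroup (G × G)) :=
  {r | ∃ x y h : G, r = FreeGroup.of (x * y, h) *
      (FreeGroup.of (x * y * x⁻¹, x * h * x⁻¹) * FreeGroup.of (x, h))⁻¹} ∪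
  {r | ∃ x h k : G, r = FreeGroup.of (x, h * k) *
      (FreeGroup.of (x, h) * FreeGroup.of (h * x * h⁻¹, h * k * h⁻¹))⁻¹}

/-- The nonabelian tensor square `G ⊗ G` (with the conjugation action). -/
abbrev TensorSquare (G : Type*) [Group G] : Type _ :=
  PresentedGroup (tensorRels G)

/-- The generator `x ⊗ y` of the nonabelian tensor square. -/
def tmul {G : Type*} [Group G] (x y : G) : TensorSquare G :=
  PresentedGroup.of (x, y)

/-- The commutator `[x, y] = x y x⁻¹ y⁻¹`, as an element of the derived subgroup. -/
def commElt {G : Type*} [Group G] (z : G × G) : commutator G :=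
  ⟨⁅z.1, z.2⁆, Subgroup.commutator_mem_commutator (Subgroup.mem_top _) (Subgroup.mem_top _)⟩

theorem commElt_rels (G : Type*) [Group G] :
    ∀ r ∈ tensorRels G, FreeGroup.lift (commElt (G := G)) r = 1 := by
  rintro r (⟨x, y, h, rfl⟩ | ⟨x, h, k, rfl⟩)
  · apply Subtype.ext
    simp only [map_mul, map_inv, FreeGroup.lift_apply_of, commElt, Subgroup.coe_mul,
      Subgroup.coe_inv, Subgroup.coe_one, commutatorElement_def]
    group
  · apply Subtype.ext
    simp only [map_mul, map_inv, FreeGroup.lift_apply_of, commElt, Subgroup.coe_mul,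
      Subgroup.coe_inv, Subgroup.coe_one, commutatorElement_def]
    group

/-- The commutator map `κ : G ⊗ G → G'`, the homomorphism with `κ (x ⊗ y) = [x, y]`. -/
def kappa (G : Type*) [Group G] : TensorSquare G →* commutator G :=
  PresentedGroup.toGroup (commElt_rels G)

/-- `J₂(G)`, the kernel of the commutator map. -/
def J2 (G : Type*) [Group G] : Subgroup (TensorSquare G) :=
  (kappa G).ker

/-- The tensor center `Z^⊗(G)`, the set of all `g` with `g ⊗ y = 1` for all `y`. -/
def tensorCenter (G : Type*) [Group G] : Set G :=
  {g | ∀ y : G, tmul g y = 1}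

/-- The tensor degree `d^⊗(G)`, the proportion of pairs `(x, y)` with `x ⊗ y = 1`. -/
noncomputable def tensorDegree (G : Type*) [Group G] : ℚ :=
  Nat.card {z : G × G // tmul z.1 z.2 = 1} / (Nat.card G : ℚ) ^ 2

end TensorDegree

/-
The group `G` acts on `G ⊗ G` diagonally by conjugation, and `κ` makes `G ⊗ G` a crossed module
over `G`: `κ(t) • s = t s t⁻¹`, and moreover `κ(t) ⊗ h = t (h • t)⁻¹`. Hence `J₂(G)` is central and
fixed by `G`. Schur's transfer `t ↦ tⁿ`, with `n` the index of `J₂(G)`, is then a `G`-invariant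
homomorphism `ψ` into `J₂(G)`; invariance makes each `y ↦ ψ(x ⊗ y)` a homomorphism on `G`, so
`G ⊗ G` has finite exponent and the finitely generated abelian group `J₂(G)` is finite.

On the centralizer `C(x)` the map `y ↦ x ⊗ y` is a homomorphism into `J₂(G)` whose kernel is the
tensor centralizer `C⊗(x)`, so `[C(x) : C⊗(x)] ≤ |J₂(G)|`. Both degrees are averages over `x`, of
`1/[G : C⊗(x)]` and of `1/[G : C(x)]`, and the two bounds hold pointwise.
-/

namespace TensorDegree

open scoped commutatorElement

theorem eq_minFac_of_isLeast {n p : ℕ} (hp : IsLeast {q : ℕ | q.Prime ∧ q ∣ n} p) :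
    p = n.minFac := by
  obtain ⟨⟨hp_prime, hp_dvd⟩, hp_le⟩ := hp
  have hn : n ≠ 1 := fun hn => hp_prime.not_dvd_one (hn ▸ hp_dvd)
  exact le_antisymm (hp_le ⟨Nat.minFac_prime hn, Nat.minFac_dvd n⟩)
    (Nat.minFac_le_of_dvd hp_prime.two_le hp_dvd)

section Group

variable {G : Type*} [Group G]

open scoped IsMulCommutative in
theorem mul_pow_index_of_le_center {H : Subgroup G} [H.FiniteIndex] (hH : H ≤ Subgroup.center G)
    (s t : G) : (s * t) ^ H.index = s ^ H.index * t ^ H.index := by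
  have : IsMulCommutative H :=
    ⟨⟨fun a b => Subtype.ext (Subgroup.mem_center_iff.mp (hH b.2) a)⟩⟩
  have transfer_eq (g : G) : (MonoidHom.transfer (MonoidHom.id H) g : G) = g ^ H.index := by
    rw [MonoidHom.transfer_eq_pow (MonoidHom.id H) g fun k g₀ hk => ?_]
    · rfl
    · calc g₀⁻¹ * g ^ k * g₀ = g₀ * (g₀⁻¹ * g ^ k * g₀) * g₀⁻¹ :=
            eq_mul_inv_of_mul_eq (Subgroup.mem_center_iff.mp (hH hk) g₀).symm
        _ = g ^ k := by group
  simp only [← transfer_eq, map_mul, Subgroup.coe_mul]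

theorem minFac_card_le_index [Finite G] {H : Subgroup G} (hH : H ≠ ⊤) :
    (Nat.card G).minFac ≤ H.index :=
  Nat.minFac_le_of_dvd (H.one_lt_index_of_ne_top hH) H.index_dvd_card

end Group

namespace TensorSquare

variable {G H : Type*} [Group G] [Group H]

theorem hom_ext {M : Type*} [Group M] {φ ψ : TensorSquare G →* M}
    (h : ∀ x y, φ (tmul x y) = ψ (tmul x y)) : φ = ψ :=
  PresentedGroup.ext fun z => h z.1 z.2

@[elab_as_elim]
theorem induction {P : TensorSquare G → Prop} (tmul : ∀ x y, P (tmul x y)) (one : P 1)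
    (mul : ∀ s t, P s → P t → P (s * t)) (inv : ∀ t, P t → P t⁻¹) (t : TensorSquare G) : P t := by
  have ht : t ∈ Subgroup.closure (Set.range PresentedGroup.of) :=
    PresentedGroup.closure_range_of (tensorRels G) ▸ Subgroup.mem_top t
  induction ht using Subgroup.closure_induction with
  | mem _ h => obtain ⟨z, rfl⟩ := h; exact tmul z.1 z.2
  | one => exact one
  | mul _ _ _ _ hs ht => exact mul _ _ hs ht
  | inv _ _ ht => exact inv _ ht

theorem mul_tmul_conj (x y h : G) :
    tmul (x * y) h = tmul (x * y * x⁻¹) (x * h * x⁻¹) * tmul x h :=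
  PresentedGroup.mk_eq_mk_of_mul_inv_mem (Or.inl ⟨x, y, h, rfl⟩)

theorem tmul_mul_conj (x h k : G) :
    tmul x (h * k) = tmul x h * tmul (h * x * h⁻¹) (h * k * h⁻¹) :=
  PresentedGroup.mk_eq_mk_of_mul_inv_mem (Or.inr ⟨x, h, k, rfl⟩)

theorem lift_map_rels (φ : G →* H) :
    ∀ r ∈ tensorRels G, FreeGroup.lift (fun z : G × G => tmul (φ z.1) (φ z.2)) r = 1 := by
  rintro r (⟨x, y, h, rfl⟩ | ⟨x, h, k, rfl⟩) <;>
    simp only [map_mul, map_inv, FreeGroup.lift_apply_of, mul_inv_eq_one]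
  · exact mul_tmul_conj _ _ _
  · exact tmul_mul_conj _ _ _

/-- The homomorphism `G ⊗ G → H ⊗ H` induced by a homomorphism `G → H`. -/
def map (φ : G →* H) : TensorSquare G →* TensorSquare H :=
  PresentedGroup.toGroup (lift_map_rels φ)

@[simp]
theorem map_tmul (φ : G →* H) (x y : G) : map φ (tmul x y) = tmul (φ x) (φ y) :=
  PresentedGroup.toGroup.of (lift_map_rels φ)

theorem map_id : map (MonoidHom.id G) = MonoidHom.id (TensorSquare G) :=
  hom_ext fun _ _ => map_tmul _ _ _

theorem map_comp {K : Type*} [Group K] (ψ : H →* K) (φ : G →* H) :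
    map (ψ.comp φ) = (map ψ).comp (map φ) :=
  hom_ext fun _ _ => by simp only [map_tmul, MonoidHom.comp_apply]

/-- The diagonal conjugation action of `G` on `G ⊗ G`, `g • (x ⊗ y) = ᵍx ⊗ ᵍy`. -/
instance : MulDistribMulAction G (TensorSquare G) where
  smul g := map (MulAut.conj g).toMonoidHom
  one_smul t := by
    change map (MulAut.conj 1).toMonoidHom t = t
    rw [map_one]
    exact DFunLike.congr_fun map_id t
  mul_smul g h t := by
    change map (MulAut.conj (g * h)).toMonoidHom t = _
    rw [map_mul]
    exact DFunLike.congr_fun (map_comp (MulAut.conj g).toMonoidHom (MulAut.conj h).toMonoidHom) t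
  smul_mul g := map_mul (map (MulAut.conj g).toMonoidHom)
  smul_one g := map_one (map (MulAut.conj g).toMonoidHom)

theorem smul_tmul (g x y : G) : g • tmul x y = tmul (g * x * g⁻¹) (g * y * g⁻¹) :=
  map_tmul (MulAut.conj g).toMonoidHom x y

theorem mul_tmul (x y h : G) : tmul (x * y) h = x • tmul y h * tmul x h := by
  rw [smul_tmul, mul_tmul_conj]

theorem tmul_mul (x h k : G) : tmul x (h * k) = tmul x h * h • tmul x k := by
  rw [smul_tmul, tmul_mul_conj]

@[simp]
theorem one_tmul (y : G) : tmul 1 y = 1 := by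
  simpa using mul_tmul 1 1 y

@[simp]
theorem tmul_one (x : G) : tmul x 1 = 1 := by
  simpa using tmul_mul x 1 1

theorem smul_inv_tmul (x y : G) : x • tmul x⁻¹ y = (tmul x y)⁻¹ := by
  rw [eq_inv_iff_mul_eq_one, ← mul_tmul, mul_inv_cancel, one_tmul]

theorem smul_tmul_inv (x y : G) : y • tmul x y⁻¹ = (tmul x y)⁻¹ := by
  rw [eq_inv_iff_mul_eq_one, mul_eq_one_comm, ← tmul_mul, mul_inv_cancel, tmul_one]

-- Compare the two expansions of `x * y ⊗ h * k`.
theorem semiconjBy_tmul_smul_tmul (x h y k : G) :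
    SemiconjBy (tmul x h) ((h * x) • tmul y k) ((x * h) • tmul y k) := by
  have expand_right :
      tmul (x * y) (h * k) = x • tmul y h * tmul x h * ((h * x) • tmul y k * h • tmul x k) := by
    rw [tmul_mul, mul_tmul, mul_tmul, smul_mul', smul_smul]
  have expand_left :
      tmul (x * y) (h * k) = x • tmul y h * (x * h) • tmul y k * (tmul x h * h • tmul x k) := by
    rw [mul_tmul, tmul_mul, tmul_mul, smul_mul', smul_smul]
  have h_eq := expand_right.symm.trans expand_left
  simp only [mul_assoc, mul_right_inj] at h_eq
  simpa only [SemiconjBy, ← mul_assoc, mul_left_inj] using h_eq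

theorem semiconjBy_tmul_smul (x h : G) (s : TensorSquare G) :
    SemiconjBy (tmul x h) ((h * x) • s) ((x * h) • s) := by
  induction s using TensorSquare.induction with
  | tmul y k => exact semiconjBy_tmul_smul_tmul x h y k
  | one => simp only [smul_one, SemiconjBy.one_right]
  | mul s t hs ht => simpa only [smul_mul'] using hs.mul_right ht
  | inv s hs => simpa only [smul_inv'] using hs.inv_right

theorem commutator_smul (x h : G) (s : TensorSquare G) :
    ⁅x, h⁆ • s = tmul x h * s * (tmul x h)⁻¹ := by
  have h_semiconj := semiconjBy_tmul_smul x h ((h * x)⁻¹ • s)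
  rw [smul_inv_smul, smul_smul, mul_inv_rev, ← mul_assoc, ← commutatorElement_def] at h_semiconj
  exact eq_mul_inv_of_mul_eq h_semiconj.eq.symm

theorem conj_tmul (x y h : G) :
    tmul (y * x * y⁻¹) h = (tmul x y)⁻¹ * tmul x h * h • tmul x y :=
  calc tmul (y * x * y⁻¹) h = y • tmul x (y⁻¹ * (h * y)) := by
        rw [smul_tmul]; group
    _ = y • tmul x y⁻¹ * tmul x (h * y) := by rw [tmul_mul, smul_mul', smul_inv_smul]
    _ = (tmul x y)⁻¹ * tmul x h * h • tmul x y := by rw [smul_tmul_inv, tmul_mul, mul_assoc]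

-- Expand `x ⊗ h` along the factorization `x = [x, y] * ʸx`.
theorem commutator_tmul (x y h : G) : tmul ⁅x, y⁆ h = tmul x y * (h • tmul x y)⁻¹ := by
  have h_expand : tmul x h =
      tmul x h * (h • tmul x y * (tmul x y)⁻¹ * tmul ⁅x, y⁆ h) := by
    calc tmul x h = tmul (⁅x, y⁆ * (y * x * y⁻¹)) h := by
          rw [commutatorElement_def]; group
      _ = tmul x y * ((tmul x y)⁻¹ * tmul x h * h • tmul x y) * (tmul x y)⁻¹
            * tmul ⁅x, y⁆ h := by rw [mul_tmul, conj_tmul, commutator_smul]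
      _ = _ := by group
  rw [left_eq_mul, mul_eq_one_iff_inv_eq] at h_expand
  rw [← h_expand, mul_inv_rev, inv_inv]

theorem coe_kappa_tmul (x y : G) : (kappa G (tmul x y) : G) = ⁅x, y⁆ :=
  congrArg Subtype.val (PresentedGroup.toGroup.of (commElt_rels G) (x := (x, y)))

theorem coe_kappa_smul (t s : TensorSquare G) : (kappa G t : G) • s = t * s * t⁻¹ := by
  have h_conj : (MulDistribMulAction.toMulAut G (TensorSquare G)).comp
      ((commutator G).subtype.comp (kappa G)) = MulAut.conj :=
    hom_ext fun x y => MulEquiv.ext fun s => by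
      simp only [MonoidHom.comp_apply, Subgroup.subtype_apply, coe_kappa_tmul,
        MulDistribMulAction.toMulAut_apply, MulDistribMulAction.toMulEquiv_apply,
        commutator_smul, MulAut.conj_apply]
  exact DFunLike.congr_fun (DFunLike.congr_fun h_conj t) s

theorem tmul_kappa_left (t : TensorSquare G) (h : G) :
    tmul (kappa G t : G) h = t * (h • t)⁻¹ := by
  induction t using TensorSquare.induction with
  | tmul x y => rw [coe_kappa_tmul, commutator_tmul]
  | one => simp only [map_one, OneMemClass.coe_one, one_tmul, smul_one, inv_one, mul_one]
  | mul s t hs ht =>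
    rw [map_mul, Subgroup.coe_mul, mul_tmul, hs, ht, coe_kappa_smul, smul_mul']
    group
  | inv t ht =>
    rw [map_inv, Subgroup.coe_inv, ← smul_left_cancel_iff (kappa G t : G), smul_inv_tmul, ht,
      coe_kappa_smul, smul_inv']
    group

end TensorSquare

section J2

open TensorSquare

variable {G : Type*} [Group G]

theorem coe_kappa_of_mem_J2 {t : TensorSquare G} (ht : t ∈ J2 G) : (kappa G t : G) = 1 :=
  congrArg Subtype.val (MonoidHom.mem_ker.mp ht)

theorem smul_eq_self_of_mem_J2 {t : TensorSquare G} (ht : t ∈ J2 G) (g : G) : g • t = t := by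
  have h := tmul_kappa_left t g
  rw [coe_kappa_of_mem_J2 ht, one_tmul] at h
  exact (mul_inv_eq_one.mp h.symm).symm

theorem J2_le_center : J2 G ≤ Subgroup.center (TensorSquare G) := fun t ht =>
  Subgroup.mem_center_iff.mpr fun s => by
    have h := coe_kappa_smul t s
    rw [coe_kappa_of_mem_J2 ht, one_smul] at h
    exact eq_mul_inv_iff_mul_eq.mp h

instance : IsMulCommutative (J2 G) :=
  ⟨⟨fun s t => Subtype.ext (Subgroup.mem_center_iff.mp (J2_le_center t.2) s)⟩⟩

instance : (J2 G).Normal := MonoidHom.normal_ker _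

instance [Finite G] : (J2 G).FiniteIndex := Subgroup.finiteIndex_ker _

theorem pow_exponent_eq_one_of_smul_invariant {A : Type*} [CommGroup A]
    (ψ : TensorSquare G →* A) (hψ : ∀ (g : G) t, ψ (g • t) = ψ t) (t : TensorSquare G) :
    ψ t ^ Monoid.exponent G = 1 := by
  let tmulHom (x : G) : G →* A :=
    { toFun y := ψ (tmul x y)
      map_one' := by rw [tmul_one, map_one]
      map_mul' y z := by rw [tmul_mul, map_mul, hψ] }
  have h_eq_one : (powMonoidHom (Monoid.exponent G)).comp ψ = 1 := hom_ext fun x y =>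
    calc tmulHom x y ^ Monoid.exponent G = tmulHom x (y ^ Monoid.exponent G) :=
          (map_pow _ _ _).symm
      _ = 1 := by rw [Monoid.pow_exponent_eq_one, map_one]
  exact DFunLike.congr_fun h_eq_one t

open scoped IsMulCommutative in
theorem pow_index_mul_exponent_eq_one [(J2 G).FiniteIndex] (t : TensorSquare G) :
    t ^ ((J2 G).index * Monoid.exponent G) = 1 := by
  let ψ : TensorSquare G →* J2 G :=
    { toFun s := ⟨s ^ (J2 G).index, Subgroup.pow_index_mem _ s⟩
      map_one' := Subtype.ext (one_pow _)
      map_mul' r s := Subtype.ext (mul_pow_index_of_le_center J2_le_center r s) }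
  have hψ (g : G) (s : TensorSquare G) : ψ (g • s) = ψ s := Subtype.ext <| by
    change (g • s) ^ (J2 G).index = s ^ (J2 G).index
    rw [← smul_pow', smul_eq_self_of_mem_J2 (Subgroup.pow_index_mem _ s)]
  rw [pow_mul]
  exact congrArg Subtype.val (pow_exponent_eq_one_of_smul_invariant ψ hψ t)

instance [Finite G] : Group.FG (TensorSquare G) :=
  Group.fg_iff.mpr ⟨_, PresentedGroup.closure_range_of (tensorRels G), Set.finite_range _⟩

open scoped IsMulCommutative in
instance finite_J2 [Finite G] : Finite (J2 G) := by
  have : Group.FG (J2 G) := Subgroup.fg_of_index_ne_zero _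
  have h_exp : 0 < (J2 G).index * Monoid.exponent G :=
    Nat.mul_pos (Nat.pos_of_ne_zero Subgroup.FiniteIndex.index_ne_zero)
      (Nat.pos_of_ne_zero Monoid.exponent_ne_zero_of_finite)
  exact CommGroup.finite_of_fg_isMulTorsion _ fun t => isOfFinOrder_iff_pow_eq_one.mpr
    ⟨_, h_exp, Subtype.ext (pow_index_mul_exponent_eq_one (t : TensorSquare G))⟩

end J2

section TensorCentralizer

open TensorSquare

variable {G : Type*} [Group G]

/-- The tensor centralizer of `x`, consisting of all `y` with `x ⊗ y = 1`. -/
def tensorCentralizer (x : G) : Subgroup G where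
  carrier := {y | tmul x y = 1}
  one_mem' := tmul_one x
  mul_mem' {y z} (hy : tmul x y = 1) (hz : tmul x z = 1) :=
    show tmul x (y * z) = 1 by rw [tmul_mul, hy, hz, smul_one, mul_one]
  inv_mem' {y} (hy : tmul x y = 1) :=
    show tmul x y⁻¹ = 1 by rw [← smul_left_cancel_iff y, smul_tmul_inv, hy, inv_one, smul_one]

theorem mem_tensorCentralizer {x y : G} : y ∈ tensorCentralizer x ↔ tmul x y = 1 := Iff.rfl

theorem tensorCentralizer_eq_top_iff {x : G} : tensorCentralizer x = ⊤ ↔ x ∈ tensorCenter G :=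
  Subgroup.eq_top_iff' _

theorem tmul_mem_J2_iff {x y : G} : tmul x y ∈ J2 G ↔ y ∈ Subgroup.centralizer {x} := by
  rw [J2, MonoidHom.mem_ker, ← OneMemClass.coe_eq_one, coe_kappa_tmul,
    commutatorElement_eq_one_iff_mul_comm, Subgroup.mem_centralizer_singleton_iff, eq_comm]

theorem tensorCentralizer_le_centralizer (x : G) :
    tensorCentralizer x ≤ Subgroup.centralizer {x} := fun _ hy =>
  tmul_mem_J2_iff.mp (mem_tensorCentralizer.mp hy ▸ one_mem (J2 G))

theorem tensorCenter_subset_center : tensorCenter G ⊆ Subgroup.center G := fun x hx =>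
  Set.singleton_subset_iff.mp <| Subgroup.centralizer_eq_top_iff_subset.mp <|
    top_le_iff.mp (tensorCentralizer_eq_top_iff.mpr hx ▸ tensorCentralizer_le_centralizer x)

/-- The homomorphism `y ↦ x ⊗ y` from the centralizer of `x` to `J₂(G)`. -/
def centralizerHom (x : G) : Subgroup.centralizer {x} →* J2 G where
  toFun y := ⟨tmul x y, tmul_mem_J2_iff.mpr y.2⟩
  map_one' := Subtype.ext (tmul_one x)
  map_mul' y z := Subtype.ext <|
    calc tmul x (y * z : G) = tmul x y * (y : G) • tmul x z := tmul_mul _ _ _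
      _ = tmul x y * tmul x z := by rw [smul_eq_self_of_mem_J2 (tmul_mem_J2_iff.mpr z.2)]

theorem ker_centralizerHom (x : G) :
    (centralizerHom x).ker = (tensorCentralizer x).subgroupOf (Subgroup.centralizer {x}) :=
  Subgroup.ext fun _ => Subtype.ext_iff

theorem index_tensorCentralizer_dvd (x : G) :
    (tensorCentralizer x).index ∣ Nat.card (J2 G) * (Subgroup.centralizer {x}).index := by
  rw [← Subgroup.relIndex_mul_index (tensorCentralizer_le_centralizer x), Subgroup.relIndex,
    ← ker_centralizerHom, Subgroup.index_ker]
  exact Nat.mul_dvd_mul_right (Subgroup.card_subgroup_dvd_card _) _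

theorem index_centralizer_of_mem_center {x : G} (hx : x ∈ Subgroup.center G) :
    (Subgroup.centralizer {x}).index = 1 := by
  rw [Subgroup.index_eq_one, Subgroup.centralizer_eq_top_iff_subset]
  exact Set.singleton_subset_iff.mpr hx

theorem index_tensorCentralizer_of_mem_tensorCenter {x : G} (hx : x ∈ tensorCenter G) :
    (tensorCentralizer x).index = 1 :=
  Subgroup.index_eq_one.mpr (tensorCentralizer_eq_top_iff.mpr hx)

end TensorCentralizer

section Averages

open scoped BigOperators

variable {G : Type*} [Group G] [Fintype G]

theorem expect_indicator_const {α : Type*} [Fintype α] (S : Set α) (a : ℚ) :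
    𝔼 x, S.indicator (fun _ => a) x = (Nat.card S : ℚ) / Nat.card α * a := by
  classical
  rw [Fintype.expect_eq_sum_div_card, Finset.sum_indicator_eq_sum_filter, Finset.sum_const,
    nsmul_eq_mul, Nat.card_eq_fintype_card, Nat.card_eq_fintype_card, Fintype.card_subtype]
  ring

theorem card_mem_div_card_sq_eq_expect (H : G → Subgroup G) :
    (Nat.card {z : G × G // z.2 ∈ H z.1} : ℚ) / (Nat.card G : ℚ) ^ 2 =
      𝔼 x, ((H x).index : ℚ)⁻¹ := by
  have h_card : (Nat.card {z : G × G // z.2 ∈ H z.1} : ℚ) = ∑ x, (Nat.card (H x) : ℚ) := by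
    rw [Nat.card_congr (Equiv.subtypeProdEquivSigmaSubtype fun x y => y ∈ H x), Nat.card_sigma,
      Nat.cast_sum]
  have h_index (x : G) : ((H x).index : ℚ)⁻¹ = Nat.card (H x) / Nat.card G := by
    rw [← (H x).card_mul_index, Nat.cast_mul, div_mul_cancel_left₀]
    exact_mod_cast Nat.card_pos.ne'
  simp_rw [h_index, ← Finset.expect_div, Fintype.expect_eq_sum_div_card, h_card,
    Nat.card_eq_fintype_card]
  ring

theorem tensorDegree_eq_expect : tensorDegree G = 𝔼 x : G, ((tensorCentralizer x).index : ℚ)⁻¹ :=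
  card_mem_div_card_sq_eq_expect tensorCentralizer

theorem commProb_eq_expect :
    commProb G = 𝔼 x : G, ((Subgroup.centralizer {x}).index : ℚ)⁻¹ := by
  simp_rw [← card_mem_div_card_sq_eq_expect, Subgroup.mem_centralizer_singleton_iff, commProb,
    commute_iff_eq, eq_comm]

end Averages

section Bounds

variable {G : Type*} [Group G] [Finite G]

theorem le_inv_index_tensorCentralizer (x : G) :
    ((Subgroup.centralizer {x}).index : ℚ)⁻¹ / Nat.card (J2 G)
        + (tensorCenter G).indicator (fun _ => 1 - 1 / (Nat.card (J2 G) : ℚ)) x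
      ≤ ((tensorCentralizer x).index : ℚ)⁻¹ := by
  by_cases hx : x ∈ tensorCenter G
  · rw [Set.indicator_of_mem hx, index_tensorCentralizer_of_mem_tensorCenter hx,
      index_centralizer_of_mem_center (tensorCenter_subset_center hx)]
    apply le_of_eq
    ring
  · have h_index : (tensorCentralizer x).index ≤
        Nat.card (J2 G) * (Subgroup.centralizer {x}).index :=
      Nat.le_of_dvd (Nat.mul_pos Nat.card_pos (Nat.pos_of_ne_zero Subgroup.index_ne_zero_of_finite))
        (index_tensorCentralizer_dvd x)
    have h_pos : (0 : ℚ) < (tensorCentralizer x).index :=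
      Nat.cast_pos.mpr (Nat.pos_of_ne_zero Subgroup.index_ne_zero_of_finite)
    rw [Set.indicator_of_notMem hx, add_zero, div_eq_mul_inv, ← mul_inv_rev]
    exact inv_anti₀ h_pos (mod_cast h_index)

theorem inv_index_tensorCentralizer_le (x : G) :
    ((tensorCentralizer x).index : ℚ)⁻¹
        + (Subgroup.center G : Set G).indicator (fun _ => 1 - 1 / ((Nat.card G).minFac : ℚ)) x
      ≤ ((Subgroup.centralizer {x}).index : ℚ)⁻¹
        + (tensorCenter G).indicator (fun _ => 1 - 1 / ((Nat.card G).minFac : ℚ)) x := by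
  by_cases hx_tensor : x ∈ tensorCenter G
  · have hx_center := tensorCenter_subset_center hx_tensor
    rw [Set.indicator_of_mem hx_tensor, Set.indicator_of_mem hx_center,
      index_tensorCentralizer_of_mem_tensorCenter hx_tensor,
      index_centralizer_of_mem_center hx_center]
  rw [Set.indicator_of_notMem hx_tensor, add_zero]
  by_cases hx_center : x ∈ Subgroup.center G
  · have h_index : (Nat.card G).minFac ≤ (tensorCentralizer x).index :=
      minFac_card_le_index (mt tensorCentralizer_eq_top_iff.mp hx_tensor)
    have h_inv : ((tensorCentralizer x).index : ℚ)⁻¹ ≤ ((Nat.card G).minFac : ℚ)⁻¹ :=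
      inv_anti₀ (Nat.cast_pos.mpr (Nat.minFac_pos _)) (mod_cast h_index)
    rw [Set.indicator_of_mem hx_center, index_centralizer_of_mem_center hx_center, Nat.cast_one,
      inv_one, one_div]
    linarith
  · have h_index := Subgroup.index_antitone (tensorCentralizer_le_centralizer x)
    rw [Set.indicator_of_notMem (mt SetLike.mem_coe.mp hx_center), add_zero]
    exact inv_anti₀ (Nat.cast_pos.mpr (Nat.pos_of_ne_zero Subgroup.index_ne_zero_of_finite))
      (mod_cast h_index)

theorem le_tensorDegree :
    commProb G / (Nat.card (J2 G) : ℚ)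
        + (Nat.card (tensorCenter G) : ℚ) / (Nat.card G : ℚ) * (1 - 1 / (Nat.card (J2 G) : ℚ))
      ≤ tensorDegree G := by
  have := Fintype.ofFinite G
  rw [commProb_eq_expect, tensorDegree_eq_expect, Finset.expect_div, ← expect_indicator_const,
    ← Finset.expect_add_distrib]
  exact Finset.expect_le_expect fun x _ => le_inv_index_tensorCentralizer x

theorem tensorDegree_le_commProb_sub :
    tensorDegree G ≤ commProb G - (1 - 1 / ((Nat.card G).minFac : ℚ))
      * (((Nat.card (Subgroup.center G) : ℚ) - (Nat.card (tensorCenter G) : ℚ))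
        / (Nat.card G : ℚ)) := by
  have := Fintype.ofFinite G
  have h_mean := Finset.expect_le_expect fun x (_ : x ∈ Finset.univ) =>
    inv_index_tensorCentralizer_le (G := G) x
  rw [Finset.expect_add_distrib, Finset.expect_add_distrib, expect_indicator_const,
    expect_indicator_const, ← tensorDegree_eq_expect, ← commProb_eq_expect] at h_mean
  simp only [SetLike.coe_sort_coe] at h_mean
  linear_combination h_mean

end Bounds

end TensorDegree

open TensorDegree in
theorem theorem2p3 {G : Type*} [Group G] [Finite G] (p : ℕ)
    (hp : IsLeast {q : ℕ | q.Prime ∧ q ∣ Nat.card G} p) :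
    Finite (J2 G) ∧
    commProb G / (Nat.card (J2 G) : ℚ)
        + (Nat.card (tensorCenter G) : ℚ) / (Nat.card G : ℚ)
          * (1 - 1 / (Nat.card (J2 G) : ℚ))
      ≤ tensorDegree G ∧
    tensorDegree G ≤
      commProb G - (1 - 1 / (p : ℚ))
        * (((Nat.card (Subgroup.center G) : ℚ) - (Nat.card (tensorCenter G) : ℚ))
          / (Nat.card G : ℚ)) := by
  obtain rfl := eq_minFac_of_isLeast hp
  exact ⟨finite_J2, le_tensorDegree, tensorDegree_le_commProb_sub⟩
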